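/- Let $\bar{\mathbb R}=\mathbb R\cup\{\infty\}$; a function with values in $\bar{\mathbb R}$ is proper if it is not identically $\infty$. Let $L_2(0,1)$ be the space of square-integrable random variables on $(0,1)$ with Lebesgue measure, let $\mathcal P_2(\mathbb R^k)$ be the set of Borel probability measures on $\mathbb R^k$ with finite second moment, and give $\mathcal P_2(\mathbb R)$ the topology of the Wasserstein metric $W_2$. Write $\mu_X$ for the law of $X$. Let $\mathcal F$ be the set of lower semi-continuous, proper, convex functions $f:L_2(0,1)\to\bar{\mathbb R}$ that are symmetric, i.e. $f(X)=f(X')$ whenever $\mu_X=\mu_{X'}$. Let $\mathfrak F$ be the set of lower semi-continuous, proper functions $\mathfrak f:\mathcal P_2(\mathbb R)\to\bar{\mathbb R}$ that are convex in the sense that $\mathfrak f(\mu_{\alpha X+(1-\alpha)X'})\le\alpha\,\mathfrak f(\mu)+(1-\alpha)\,\mathfrak f(\mu')$ for all $\mu,\mu'\in\mathcal P_2(\mathbb R)$, every coupling $\pi$ of $\mu$ and $\mu'$, $(X,X')\sim\pi$, and all $\alpha\in[0,1]$. For $f\in\mathcal F$ let $\partial f$ be the set of pairs $(X,G)\in L_2(0,1)^2$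 with $f(X')\ge f(X)+\mathbb E[G(X'-X)]$ for all $X'\in L_2(0,1)$. The Wasserstein subdifferential of $f$ is $\mathfrak D f=\{\mu_{(X,G)} : (X,G)\in\partial f\}\subset\mathcal P_2(\mathbb R^2)$, and that of $\mathfrak f\in\mathfrak F$ is $\mathfrak D\mathfrak f=\mathfrak D f$ for the function $f(X)=\mathfrak f(\mu_X)$. A set $\mathfrak R\subset\mathcal P_2(\mathbb R^2)$ is jointly cyclically monotone if for every $n$, all $\pi_1,\dots,\pi_n\in\mathfrak R$ (not necessarily distinct), all random vectors $(X_1,G_1,\dots,X_n,G_n)$ with $(X_j,G_j)\sim\pi_j$ for all $j$, and all permutations $\sigma$ of $\{1,\dots,n\}$, $$\sum_{j=1}^n\mathbb E[X_jG_j]\ \ge\ \sum_{j=1}^n\mathbb E[X_jG_{\sigma(j)}].$$ It is maximally jointly cyclically monotone if, in addition, it is not a proper subset of another jointly cyclically monotone set. **Proposition.** 1. For every $\mathfrak f\in\mathfrak F$ and every $f\in\mathcal F$, the sets $\mathfrak D\mathfrak f$ and $\mathfrak D f$ are maximally jointly cyclically monotone. 2. Conversely, if $\mathfrak R\subset\mathcal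 P_2(\mathbb R^2)$ is maximally jointly cyclically monotone, then $\mathfrak R=\mathfrak D\mathfrak f=\mathfrak D f$ for some $\mathfrak f\in\mathfrak F$ and $f\in\mathcal F$ with $f(X)=\mathfrak f(\mu_X)$ for all $X\in L_2(0,1)$; moreover $\mathfrak f$ is unique in $\mathfrak F$, and $f$ is unique in $\mathcal F$, up to an additive real constant. 3. If $\mathfrak R\subset\mathcal P_2(\mathbb R^2)$ is jointly cyclically monotone, then $\mathfrak R\subset\mathfrak D\mathfrak f$ and $\mathfrak R\subset\mathfrak D f$ for some $\mathfrak f\in\mathfrak F$ and $f\in\mathcal F$ with $f(X)=\mathfrak f(\mu_X)$ for all $X\in L_2(0,1)$. -/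

import Mathlib

open MeasureTheory

namespace WassersteinSubdiff

noncomputable section

/-- `P2 E`: Borel probability measures on `E` with finite second moment. It is used for `E = ℝ` and
`E = ℝ × ℝ`. (Mathlib's norm on `ℝ × ℝ` is the maximum norm; it is equivalent to the Euclidean norm,
so the measures with finite second moment are the same.) -/
@[ext]
structure P2 (E : Type) [NormedAddCommGroup E] [MeasurableSpace E] where
  toMeasure : Measure E
  isProbabilityMeasure : IsProbabilityMeasure toMeasure
  memLp_id : MemLp id 2 toMeasure

attribute [instance] P2.isProbabilityMeasure

/-- The law of a square-integrable random variable on a probability space. -/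
def lawOf {Ω E : Type} [MeasurableSpace Ω] [NormedAddCommGroup E] [MeasurableSpace E]
    [BorelSpace E] [SecondCountableTopology E] (P : Measure Ω) [IsProbabilityMeasure P]
    (Z : Ω → E) (hZ : MemLp Z 2 P) : P2 E where
  toMeasure := P.map Z
  isProbabilityMeasure := Measure.isProbabilityMeasure_map hZ.1.aemeasurable
  memLp_id := (memLp_map_measure_iff aestronglyMeasurable_id hZ.1.aemeasurable).2 hZ

/-! ### Wasserstein space of order 2 on the line -/

/-- `π ∈ Π(μ, ν)`: the first marginal of `π` is `μ` and the second marginal is `ν`. -/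
structure IsCoupling (π : Measure (ℝ × ℝ)) (μ ν : P2 ℝ) : Prop where
  fst_eq : π.map Prod.fst = μ.toMeasure
  snd_eq : π.map Prod.snd = ν.toMeasure

theorem IsCoupling.isProbabilityMeasure {π : Measure (ℝ × ℝ)} {μ ν : P2 ℝ}
    (h : IsCoupling π μ ν) : IsProbabilityMeasure π := by
  have h1 : IsProbabilityMeasure (π.map Prod.fst) := h.fst_eq ▸ μ.isProbabilityMeasure
  exact Measure.isProbabilityMeasure_of_map Prod.fst

theorem IsCoupling.memLp_fst {π : Measure (ℝ × ℝ)} {μ ν : P2 ℝ}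
    (h : IsCoupling π μ ν) : MemLp (fun p : ℝ × ℝ => p.1) 2 π := by
  have h1 := μ.memLp_id
  rw [← h.fst_eq] at h1
  exact (memLp_map_measure_iff aestronglyMeasurable_id measurable_fst.aemeasurable).1 h1

theorem IsCoupling.memLp_snd {π : Measure (ℝ × ℝ)} {μ ν : P2 ℝ}
    (h : IsCoupling π μ ν) : MemLp (fun p : ℝ × ℝ => p.2) 2 π := by
  have h1 := ν.memLp_id
  rw [← h.snd_eq] at h1
  exact (memLp_map_measure_iff aestronglyMeasurable_id measurable_snd.aemeasurable).1 h1

/-- The Wasserstein distance of order 2 on `P2 ℝ`. The infimum is over a non-empty set (it contains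
the product measure), and every integrand is integrable. -/
def W2 (μ ν : P2 ℝ) : ℝ :=
  Real.sqrt (sInf {c : ℝ | ∃ π : Measure (ℝ × ℝ),
    IsCoupling π μ ν ∧ c = ∫ p, (p.1 - p.2) ^ 2 ∂π})

/-- The topology on `P2 ℝ` induced by `W2`: a set is open if it contains a `W2`-ball around each of
its points. -/
instance instTopologicalSpaceP2 : TopologicalSpace (P2 ℝ) where
  IsOpen U := ∀ μ ∈ U, ∃ ε > 0, ∀ ν, W2 μ ν < ε → ν ∈ U
  isOpen_univ := fun _ _ => ⟨1, one_pos, fun _ _ => trivial⟩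
  isOpen_inter := by
    rintro U V hU hV μ ⟨h1, h2⟩
    obtain ⟨a, ha, h3⟩ := hU μ h1
    obtain ⟨b, hb, h4⟩ := hV μ h2
    exact ⟨min a b, lt_min ha hb, fun ν hν =>
      ⟨h3 ν (hν.trans_le (min_le_left _ _)), h4 ν (hν.trans_le (min_le_right _ _))⟩⟩
  isOpen_sUnion := by
    rintro S hS μ ⟨U, hU, hμ⟩
    obtain ⟨a, ha, h⟩ := hS U hU μ hμ
    exact ⟨a, ha, fun ν hν => ⟨U, hU, h ν hν⟩⟩

/-- For a coupling `π` of `μ` and `ν`, the measure `α μ ⊕_π (1 - α) ν`: the law of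
`α X + (1 - α) X'` where `(X, X') ∼ π`. -/
def interp {π : Measure (ℝ × ℝ)} {μ ν : P2 ℝ} (h : IsCoupling π μ ν) (α : ℝ) : P2 ℝ :=
  haveI := h.isProbabilityMeasure
  lawOf π (fun p : ℝ × ℝ => α * p.1 + (1 - α) * p.2)
    ((h.memLp_fst.const_mul α).add (h.memLp_snd.const_mul (1 - α)))

/-! ### Random variables on the unit interval -/

/-- Lebesgue measure on `(0, 1)`. -/
abbrev unifMeasure : Measure ℝ := volume.restrict (Set.Ioo 0 1)

instance instIsProbabilityMeasureUnif : IsProbabilityMeasure unifMeasure :=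
  ⟨by simp [unifMeasure]⟩

/-- The Hilbert space `L₂(0, 1)`. -/
abbrev L2 : Type := Lp ℝ 2 unifMeasure

/-- The law `μ_X` of `X ∈ L₂(0, 1)`. -/
def law (X : L2) : P2 ℝ := lawOf unifMeasure X (Lp.memLp X)

/-- The joint law `μ_{(X, G)}` of `X, G ∈ L₂(0, 1)`. -/
def jointLaw (X G : L2) : P2 (ℝ × ℝ) :=
  lawOf unifMeasure (fun t => (X t, G t)) (MemLp.of_fst_snd ⟨Lp.memLp X, Lp.memLp G⟩)

/-! ### The two function spaces

Functions with values in `ℝ ∪ {∞}` are functions into `EReal` that omit the value `-∞`; this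
condition is part of `IsProper`. -/

/-- The function takes values in `ℝ ∪ {∞}` and is not identically `∞`. -/
def IsProper {α : Type} (f : α → EReal) : Prop :=
  (∀ x, f x ≠ ⊥) ∧ ∃ x, f x ≠ ⊤

/-- The space `𝓕` of lower semi-continuous, proper, symmetric, convex functions on `L₂(0, 1)`. -/
structure SymmConvexL2 (f : L2 → EReal) : Prop where
  lsc : LowerSemicontinuous f
  proper : IsProper f
  symmetric : ∀ X X' : L2, law X = law X' → f X = f X'
  convex : ∀ (X X' : L2) (α : ℝ), 0 ≤ α → α ≤ 1 →
    f (α • X + (1 - α) • X') ≤ (α : EReal) * f X + ((1 - α : ℝ) : EReal) * f X'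

/-- The space `𝔉` of lower semi-continuous, proper, convex functions on `P2 ℝ`. -/
structure ConvexP2 (f : P2 ℝ → EReal) : Prop where
  lsc : LowerSemicontinuous f
  proper : IsProper f
  convex : ∀ (μ ν : P2 ℝ) (π : Measure (ℝ × ℝ)) (h : IsCoupling π μ ν) (α : ℝ), 0 ≤ α → α ≤ 1 →
    f (interp h α) ≤ (α : EReal) * f μ + ((1 - α : ℝ) : EReal) * f ν

/-! ### Subdifferentials -/

/-- The subdifferential `∂f` as a relation: `(X, G) ∈ ∂f` iff
`f(X') ≥ f(X) + E[G (X' - X)]` for all `X' ∈ L₂(0, 1)`. -/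
def subdiff (f : L2 → EReal) : Set (L2 × L2) :=
  {q | ∀ X' : L2, f q.1 + ((∫ t, q.2 t * (X' t - q.1 t) ∂unifMeasure : ℝ) : EReal) ≤ f X'}

/-- The Wasserstein subdifferential of `f : L₂(0, 1) → ℝ ∪ {∞}`: the joint laws `μ_{(X, G)}` of the
pairs `(X, G) ∈ ∂f`. -/
def wassSubdiffL2 (f : L2 → EReal) : Set (P2 (ℝ × ℝ)) :=
  {π | ∃ X G : L2, (X, G) ∈ subdiff f ∧ jointLaw X G = π}

/-- The Wasserstein subdifferential of a function on `P2 ℝ`: that of `X ↦ f(μ_X)`. -/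
def wassSubdiffP2 (f : P2 ℝ → EReal) : Set (P2 (ℝ × ℝ)) :=
  wassSubdiffL2 fun X => f (law X)

/-! ### Joint cyclic monotonicity -/

/-- `R` is jointly cyclically monotone: for all finite families `π₁, …, πₙ` in `R` (repetitions
allowed), all random vectors `(X₁, G₁, …, Xₙ, Gₙ)`, on any probability space, with `(Xⱼ, Gⱼ) ∼ πⱼ`
for each `j`, and all permutations `σ`, one has `∑ⱼ E[Xⱼ Gⱼ] ≥ ∑ⱼ E[Xⱼ G_{σ(j)}]`. -/
def JointlyCyclicallyMonotone (R : Set (P2 (ℝ × ℝ))) : Prop :=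
  ∀ (n : ℕ) (π : Fin n → P2 (ℝ × ℝ)), (∀ j, π j ∈ R) →
    ∀ (Ω : Type) [MeasurableSpace Ω] (P : Measure Ω) [IsProbabilityMeasure P]
      (X G : Fin n → Ω → ℝ), (∀ j, AEMeasurable (X j) P) → (∀ j, AEMeasurable (G j) P) →
      (∀ j, P.map (fun ω => (X j ω, G j ω)) = (π j).toMeasure) →
      ∀ σ : Equiv.Perm (Fin n),
        ∑ j, ∫ ω, X j ω * G (σ j) ω ∂P ≤ ∑ j, ∫ ω, X j ω * G j ω ∂P

/-- `R` is jointly cyclically monotone and not a proper subset of another such set. -/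
def MaximallyJointlyCyclicallyMonotone (R : Set (P2 (ℝ × ℝ))) : Prop :=
  JointlyCyclicallyMonotone R ∧ ∀ S, JointlyCyclicallyMonotone S → ¬ R ⊂ S

end

end WassersteinSubdiff

open WassersteinSubdiff

/-!
The Wasserstein subdifferential is the convex subdifferential on the Hilbert space `L₂(0, 1)`, seen
through joint laws, and the proof transports Rockafellar's theory along this correspondence.

*From laws to random variables.* Two random variables `Z`, `W` on `(0, 1)` with the same law need
not be related by a measure preserving map, but they are up to a uniformly small error
(`exists_measurePreserving_abs_sub_le`): cut the line into small cells and transport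
`{Z ∈ cell}` to `{W ∈ cell}`. With `exists_L2_family`, which copies random vectors to `(0, 1)`, this
gives two facts. Lower semi-continuous convex functions on `P2 ℝ` are the same as symmetric ones on
`L₂(0, 1)` (`ConvexP2.symmConvexL2_comp_law`, `SymmConvexL2.convexP2_of_comp_law`). For symmetric
`f`, whether `(X, G) ∈ ∂f` depends only on the joint law
(`SymmConvexL2.mem_subdiff_of_jointLaw_eq`). Hence subgradient inequalities can be added along any
coupling, which is joint cyclic monotonicity.

*Maximality and uniqueness.* By Minty's theorem (`ConvexLsc.exists_resolvent`) every `X + G` is of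
the form `Y + K` with `(Y, K) ∈ ∂f`. If `law (X, G)` lies in a jointly cyclically monotone set that
contains the subdifferential, monotonicity forces `(X, G) = (Y, K)`. If `∂f = ∂f'`, then `f' - f`,
as a function of `Y + K`, has increments bounded by the squared distance, so it is constant on the
domain of `∂f`, and resolvents with a small parameter extend this to all points
(`ConvexLsc.exists_eq_add_const`).

*Existence.* For a jointly cyclically monotone `R`, `rockafellar` is the supremum of the affine
functions obtained by adding subgradient inequalities along chains of pairs with laws in `R`. Only
the law of the initial pair of a chain is fixed. This makes the potential symmetric, and it stays
finite at the law of the base point because the norms of the initial pair are determined by its law.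
-/

namespace WassersteinSubdiff

noncomputable section

/-! ### Convex analysis on a Hilbert space -/

section Hilbert

open Filter Topology
open scoped RealInnerProductSpace

variable {H : Type*} [NormedAddCommGroup H] [InnerProductSpace ℝ H]

/-- Lower semi-continuous, convex functions on a Hilbert space with values in `ℝ ∪ {∞}`, not
identically `∞`. -/
structure ConvexLsc {H : Type*} [NormedAddCommGroup H] [InnerProductSpace ℝ H]
    (f : H → EReal) : Prop where
  lsc : LowerSemicontinuous f
  ne_bot : ∀ x, f x ≠ ⊥
  exists_ne_top : ∃ x, f x ≠ ⊤
  convex : ∀ (x y : H) (t : ℝ), 0 ≤ t → t ≤ 1 →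
    f (t • x + (1 - t) • y) ≤ (t : EReal) * f x + ((1 - t : ℝ) : EReal) * f y

/-- The convex subdifferential of `f`, as a relation on a Hilbert space. -/
def hilbertSubdiff (f : H → EReal) : Set (H × H) :=
  {q | ∀ x, f q.1 + ((⟪q.2, x - q.1⟫ : ℝ) : EReal) ≤ f x}

theorem ConvexLsc.convex_le {f : H → EReal} (hf : ConvexLsc f) {x y : H} {a b t : ℝ}
    (hx : f x ≤ a) (hy : f y ≤ b) (h0 : 0 ≤ t) (h1 : t ≤ 1) :
    f (t • x + (1 - t) • y) ≤ ((t * a + (1 - t) * b : ℝ) : EReal) := by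
  refine (hf.convex x y t h0 h1).trans ?_
  rw [EReal.coe_add, EReal.coe_mul, EReal.coe_mul]
  exact add_le_add (mul_le_mul_of_nonneg_left hx (EReal.coe_nonneg.2 h0))
    (mul_le_mul_of_nonneg_left hy (EReal.coe_nonneg.2 (sub_nonneg.2 h1)))

theorem ConvexLsc.coe_toReal {f : H → EReal} (hf : ConvexLsc f) {x : H} (hx : f x ≠ ⊤) :
    ((f x).toReal : EReal) = f x :=
  EReal.coe_toReal hx (hf.ne_bot x)

/-- A subgradient exists only where the function is finite. -/
theorem ConvexLsc.ne_top_of_mem {f : H → EReal} (hf : ConvexLsc f) {x g : H}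
    (h : (x, g) ∈ hilbertSubdiff f) : f x ≠ ⊤ := by
  intro hx
  obtain ⟨y, hy⟩ := hf.exists_ne_top
  have := h y
  simp only [hx, EReal.top_add_coe, top_le_iff] at this
  exact hy this

theorem ConvexLsc.mem_hilbertSubdiff_iff {f : H → EReal} (hf : ConvexLsc f) {x g : H} :
    (x, g) ∈ hilbertSubdiff f ↔ f x ≠ ⊤ ∧
      ∀ y, f y ≠ ⊤ → (f x).toReal + ⟪g, y - x⟫ ≤ (f y).toReal := by
  constructor
  · intro h
    have hx := hf.ne_top_of_mem h
    refine ⟨hx, fun y hy => ?_⟩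
    have := h y
    simp only at this
    rw [← hf.coe_toReal hx, ← hf.coe_toReal hy] at this
    exact_mod_cast this
  · rintro ⟨hx, h⟩ y
    by_cases hy : f y = ⊤
    · simp [hy]
    · simp only
      rw [← hf.coe_toReal hx, ← hf.coe_toReal hy]
      exact_mod_cast h y hy

/-- Lower semi-continuity at one point of the domain, spread out by convexity, bounds the function
below by a function of linear growth. -/
theorem ConvexLsc.exists_linear_lower_bound {f : H → EReal} (hf : ConvexLsc f) (y₀ : H) :
    ∃ a b : ℝ, 0 ≤ b ∧ ∀ y, f y ≠ ⊤ → a - b * ‖y - y₀‖ ≤ (f y).toReal := by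
  obtain ⟨y₁, h₁⟩ := hf.exists_ne_top
  obtain ⟨δ, hδ, hball⟩ : ∃ δ > 0, ∀ y, ‖y - y₁‖ < δ → (((f y₁).toReal - 1 : ℝ) : EReal) < f y := by
    have : (((f y₁).toReal - 1 : ℝ) : EReal) < f y₁ := by
      conv_rhs => rw [← hf.coe_toReal h₁]
      exact_mod_cast sub_one_lt _
    obtain ⟨δ, hδ, h⟩ := Metric.eventually_nhds_iff.1 (hf.lsc y₁ _ this)
    exact ⟨δ, hδ, fun y hy => h (by rwa [dist_eq_norm])⟩
  have key : ∀ y, f y ≠ ⊤ → (f y₁).toReal - 1 - 2 / δ * ‖y - y₁‖ ≤ (f y).toReal := by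
    intro y hy
    by_cases hn : ‖y - y₁‖ < δ
    · have := hball y hn
      rw [← hf.coe_toReal hy] at this
      have : (f y₁).toReal - 1 < (f y).toReal := by exact_mod_cast this
      have : 0 ≤ 2 / δ * ‖y - y₁‖ := by positivity
      linarith
    · push Not at hn
      have hpos : 0 < ‖y - y₁‖ := hδ.trans_le hn
      -- With this `t` the point `t • y + (1 - t) • y₁` is at distance `δ / 2` from `y₁`.
      set t := δ / (2 * ‖y - y₁‖) with ht
      have ht0 : 0 < t := by positivity
      have ht1 : t ≤ 1 := by
        rw [ht, div_le_one (by positivity)]; linarith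
      have h2 := hf.convex_le (hf.coe_toReal hy).ge (hf.coe_toReal h₁).ge ht0.le ht1
      have h3 := hball (t • y + (1 - t) • y₁) (by
        have : t • y + (1 - t) • y₁ - y₁ = t • (y - y₁) := by module
        rw [this, norm_smul, Real.norm_of_nonneg ht0.le, ht]
        field_simp
        linarith)
      have h4 : (f y₁).toReal - 1 < t * (f y).toReal + (1 - t) * (f y₁).toReal := by
        exact_mod_cast h3.trans_le h2
      have h5 : 2 / δ * ‖y - y₁‖ = 1 / t := by rw [ht]; field_simp
      rw [h5]
      have h6 : -(1 / t) < (f y).toReal - (f y₁).toReal := by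
        rw [neg_lt_iff_pos_add, ← sub_lt_iff_lt_add', zero_sub, neg_lt_iff_pos_add]
        have : 0 < t * ((f y).toReal - (f y₁).toReal + 1 / t) := by
          field_simp; linarith
        have := (pos_iff_pos_of_mul_pos this).1 ht0
        linarith
      linarith
  refine ⟨(f y₁).toReal - 1 - 2 / δ * ‖y₀ - y₁‖, 2 / δ, by positivity, fun y hy => ?_⟩
  have h1 := key y hy
  have h2 : ‖y - y₁‖ ≤ ‖y - y₀‖ + ‖y₀ - y₁‖ := norm_sub_le_norm_sub_add_norm_sub _ _ _
  have h3 : 2 / δ * ‖y - y₁‖ ≤ 2 / δ * (‖y - y₀‖ + ‖y₀ - y₁‖) := by gcongr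
  linarith

/-- The proximal functional `y ↦ f y + ‖y - z‖² / (2 r)` attains its infimum. -/
theorem ConvexLsc.exists_prox_minimizer [CompleteSpace H] {f : H → EReal} (hf : ConvexLsc f)
    {r : ℝ} (hr : 0 < r) (z : H) :
    ∃ y, f y ≠ ⊤ ∧ ∀ x, f x ≠ ⊤ →
      (f y).toReal + ‖y - z‖ ^ 2 / (2 * r) ≤ (f x).toReal + ‖x - z‖ ^ 2 / (2 * r) := by
  set g : H → ℝ := fun y => (f y).toReal + ‖y - z‖ ^ 2 / (2 * r) with hg
  obtain ⟨a, b, hb, hab⟩ := hf.exists_linear_lower_bound z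
  have hbdd : BddBelow (g '' {x | f x ≠ ⊤}) := by
    refine ⟨a - b ^ 2 * r / 2, ?_⟩
    rintro _ ⟨y, hy, rfl⟩
    have h1 := hab y hy
    have h2 : b * ‖y - z‖ ≤ ‖y - z‖ ^ 2 / (2 * r) + b ^ 2 * r / 2 := by
      have : ‖y - z‖ ^ 2 / (2 * r) + b ^ 2 * r / 2 - b * ‖y - z‖ = (‖y - z‖ - b * r) ^ 2 / (2 * r) := by
        field_simp; ring
      have : 0 ≤ (‖y - z‖ - b * r) ^ 2 / (2 * r) := by positivity
      linarith
    simp only [hg]; linarith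
  obtain ⟨x₀, hx₀⟩ := hf.exists_ne_top
  have hne : (g '' {x | f x ≠ ⊤}).Nonempty := ⟨_, x₀, hx₀, rfl⟩
  set m := sInf (g '' {x | f x ≠ ⊤}) with hm
  have hmle : ∀ x, f x ≠ ⊤ → m ≤ g x := fun x hx => csInf_le hbdd ⟨x, hx, rfl⟩
  have hseq : ∀ n : ℕ, ∃ y, f y ≠ ⊤ ∧ g y < m + 1 / ((n : ℝ) + 1) := by
    intro n
    obtain ⟨_, ⟨y, hy, rfl⟩, h⟩ := exists_lt_of_csInf_lt hne
      (show m < m + 1 / ((n : ℝ) + 1) by linarith [show 0 < 1 / ((n : ℝ) + 1) by positivity])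
    exact ⟨y, hy, h⟩
  choose y hyD hy using hseq
  -- Strong convexity of the quadratic term makes minimizing sequences Cauchy.
  have hmid : ∀ u v, f u ≠ ⊤ → f v ≠ ⊤ → ‖u - v‖ ^ 2 ≤ 8 * r * ((g u + g v) / 2 - m) := by
    intro u v hu hv
    have h1 := hf.convex_le (hf.coe_toReal hu).ge (hf.coe_toReal hv).ge
      (show (0 : ℝ) ≤ 1 / 2 by norm_num) (by norm_num)
    set w := (1 / 2 : ℝ) • u + (1 - 1 / 2 : ℝ) • v with hw
    have hwt : f w ≠ ⊤ := ne_top_of_le_ne_top (EReal.coe_ne_top _) h1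
    have h2 : (f w).toReal ≤ 1 / 2 * (f u).toReal + (1 - 1 / 2) * (f v).toReal := by
      rw [← hf.coe_toReal hwt] at h1; exact_mod_cast h1
    have h3 := hmle w hwt
    have h4 := parallelogram_law_with_norm ℝ (u - z) (v - z)
    have e1 : u - z + (v - z) = (2 : ℝ) • (w - z) := by rw [hw]; module
    have e2 : u - z - (v - z) = u - v := by abel
    rw [e1, e2, norm_smul, Real.norm_of_nonneg (by norm_num : (0 : ℝ) ≤ 2)] at h4
    have h5 : ‖w - z‖ ^ 2 / (2 * r) =
        (‖u - z‖ ^ 2 / (2 * r) + ‖v - z‖ ^ 2 / (2 * r)) / 2 - ‖u - v‖ ^ 2 / (8 * r) := by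
      field_simp; linarith
    have h6 : ‖u - v‖ ^ 2 / (8 * r) ≤ (g u + g v) / 2 - m := by
      simp only [hg] at h3 ⊢; linarith
    rw [div_le_iff₀ (by positivity)] at h6
    linarith
  have hcauchy : CauchySeq y := by
    rw [Metric.cauchySeq_iff']
    intro ε hε
    obtain ⟨N, hN⟩ := exists_nat_one_div_lt (show 0 < ε ^ 2 / (8 * r) by positivity)
    refine ⟨N, fun n hn => ?_⟩
    have h1 := hmid (y n) (y N) (hyD n) (hyD N)
    have h2 := hy n
    have h3 := hy N
    have h4 : 1 / ((n : ℝ) + 1) ≤ 1 / ((N : ℝ) + 1) := by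
      have : (N : ℝ) ≤ n := by exact_mod_cast hn
      gcongr
    have h5 : (g (y n) + g (y N)) / 2 - m < ε ^ 2 / (8 * r) := by linarith
    rw [dist_eq_norm]
    have h6 : 8 * r * ((g (y n) + g (y N)) / 2 - m) < ε ^ 2 := by
      rw [lt_div_iff₀ (by positivity)] at h5; linarith
    exact lt_of_pow_lt_pow_left₀ 2 hε.le (h1.trans_lt h6)
  obtain ⟨p, hp⟩ := cauchySeq_tendsto_of_complete hcauchy
  have hlim : Tendsto (fun n : ℕ => m + 1 / ((n : ℝ) + 1) - ‖y n - z‖ ^ 2 / (2 * r)) atTop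
      (𝓝 (m + 0 - ‖p - z‖ ^ 2 / (2 * r))) :=
    (tendsto_const_nhds.add tendsto_one_div_add_atTop_nhds_zero_nat).sub
      (((hp.sub_const z).norm.pow 2).div_const _)
  have hfp : f p ≤ ((m - ‖p - z‖ ^ 2 / (2 * r) : ℝ) : EReal) := by
    refine EReal.ge_of_forall_gt_iff_ge.1 fun c hc => ?_
    rw [add_zero] at hlim
    have h1 : c ≤ m - ‖p - z‖ ^ 2 / (2 * r) := by
      refine ge_of_tendsto hlim ?_
      filter_upwards [hp.eventually (hf.lsc p c hc)] with n hn
      rw [← hf.coe_toReal (hyD n)] at hn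
      have h1 : c < (f (y n)).toReal := by exact_mod_cast hn
      have h2 := hy n
      simp only [hg] at h2
      linarith
    exact_mod_cast h1
  have hpt : f p ≠ ⊤ := ne_top_of_le_ne_top (EReal.coe_ne_top _) hfp
  refine ⟨p, hpt, fun x hx => ?_⟩
  have h1 : (f p).toReal ≤ m - ‖p - z‖ ^ 2 / (2 * r) := by
    rw [← hf.coe_toReal hpt] at hfp; exact_mod_cast hfp
  have h2 := hmle x hx
  simp only [hg] at h2
  linarith

/-- Surjectivity of `id + r ∂f` (Minty): the minimizer of the proximal functional solves
`z ∈ y + r ∂f(y)`. -/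
theorem ConvexLsc.exists_resolvent [CompleteSpace H] {f : H → EReal} (hf : ConvexLsc f)
    {r : ℝ} (hr : 0 < r) (z : H) : ∃ y g, (y, g) ∈ hilbertSubdiff f ∧ y + r • g = z := by
  obtain ⟨y, hy, hmin⟩ := hf.exists_prox_minimizer hr z
  refine ⟨y, r⁻¹ • (z - y), ?_, by rw [smul_inv_smul₀ hr.ne']; abel⟩
  rw [hf.mem_hilbertSubdiff_iff]
  refine ⟨hy, fun x hx => ?_⟩
  have key : ∀ t : ℝ, 0 < t → t ≤ 1 → (f y).toReal + ⟪r⁻¹ • (z - y), x - y⟫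
      - t * (‖x - y‖ ^ 2 / (2 * r)) ≤ (f x).toReal := by
    intro t ht0 ht1
    have h1 := hf.convex_le (hf.coe_toReal hx).ge (hf.coe_toReal hy).ge ht0.le ht1
    set w := t • x + (1 - t) • y with hw
    have hwt : f w ≠ ⊤ := ne_top_of_le_ne_top (EReal.coe_ne_top _) h1
    have h2 : (f w).toReal ≤ t * (f x).toReal + (1 - t) * (f y).toReal := by
      rw [← hf.coe_toReal hwt] at h1; exact_mod_cast h1
    have h3 := hmin w hwt
    have e : w - z = (y - z) + t • (x - y) := by rw [hw]; module
    have h4 : ‖w - z‖ ^ 2 = ‖y - z‖ ^ 2 + 2 * t * ⟪y - z, x - y⟫ + t ^ 2 * ‖x - y‖ ^ 2 := by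
      rw [e, norm_add_sq_real, inner_smul_right, norm_smul, mul_pow, Real.norm_eq_abs, sq_abs]
      ring
    have h5 : ⟪r⁻¹ • (z - y), x - y⟫ = - (⟪y - z, x - y⟫ / r) := by
      rw [real_inner_smul_left, ← neg_sub y z, inner_neg_left]; field_simp
    rw [h5]
    rw [h4] at h3
    have h6 : (‖y - z‖ ^ 2 + 2 * t * ⟪y - z, x - y⟫ + t ^ 2 * ‖x - y‖ ^ 2) / (2 * r)
      = ‖y - z‖ ^ 2 / (2 * r) + t * (⟪y - z, x - y⟫ / r + t * (‖x - y‖ ^ 2 / (2 * r))) := by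
      field_simp; ring
    rw [h6] at h3
    have h7 : 0 ≤ t * ((f x).toReal - (f y).toReal +
        (⟪y - z, x - y⟫ / r + t * (‖x - y‖ ^ 2 / (2 * r)))) := by linarith
    have h8 := nonneg_of_mul_nonneg_right h7 ht0
    linarith
  have hlim : Tendsto (fun t : ℝ => (f y).toReal + ⟪r⁻¹ • (z - y), x - y⟫
      - t * (‖x - y‖ ^ 2 / (2 * r))) (𝓝[>] 0) (𝓝 ((f y).toReal + ⟪r⁻¹ • (z - y), x - y⟫
      - 0 * (‖x - y‖ ^ 2 / (2 * r)))) :=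
    ((continuous_const.sub (continuous_id.mul continuous_const)).tendsto _).mono_left
      nhdsWithin_le_nhds
  rw [zero_mul, sub_zero] at hlim
  refine le_of_tendsto hlim ?_
  filter_upwards [Ioc_mem_nhdsGT (zero_lt_one' ℝ)] with t ht using key t ht.1 ht.2

/-- A real function whose increments are bounded by the squared distance is constant. -/
theorem eq_of_abs_sub_le_norm_sq {ψ : H → ℝ} (h : ∀ z w, |ψ z - ψ w| ≤ ‖z - w‖ ^ 2) (z w : H) :
    ψ z = ψ w := by
  have hd : ∀ x, HasFDerivAt ψ (0 : H →L[ℝ] ℝ) x := by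
    intro x
    rw [hasFDerivAt_iff_isLittleO]
    have h1 : (fun y => ψ y - ψ x - (0 : H →L[ℝ] ℝ) (y - x)) =O[𝓝 x] fun y => ‖y - x‖ ^ 2 :=
      Asymptotics.IsBigO.of_bound 1 (Eventually.of_forall fun y => by
        simpa using h y x)
    refine h1.trans_isLittleO ?_
    have h2 : Tendsto (fun y => y - x) (𝓝 x) (𝓝 0) := by
      simpa using (tendsto_id (x := 𝓝 x)).sub_const x
    exact (Asymptotics.isLittleO_norm_pow_id one_lt_two).comp_tendsto h2
  exact is_const_of_fderiv_eq_zero (fun x => (hd x).differentiableAt) (fun x => (hd x).fderiv) z w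

/-- Two functions with the same subdifferential differ by a constant on its domain: the difference
of the two, as a function of `z = x + g` for `(x, g)` in the subdifferential, has increments of
second order. -/
theorem ConvexLsc.exists_const_on_domain [CompleteSpace H] {f f' : H → EReal} (hf : ConvexLsc f)
    (hf' : ConvexLsc f') (hsub : hilbertSubdiff f = hilbertSubdiff f') :
    ∃ c : ℝ, ∀ x g, (x, g) ∈ hilbertSubdiff f → (f' x).toReal = (f x).toReal + c := by
  choose J G hJ hJz using fun z => hf.exists_resolvent one_pos z
  have hmono : ∀ x g y k, (x, g) ∈ hilbertSubdiff f → (y, k) ∈ hilbertSubdiff f →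
      |((f' x).toReal - (f x).toReal) - ((f' y).toReal - (f y).toReal)| ≤ ⟪g - k, x - y⟫ := by
    intro x g y k hx hy
    have a1 := (hf.mem_hilbertSubdiff_iff.1 hx).2 y (hf.ne_top_of_mem hy)
    have a2 := (hf.mem_hilbertSubdiff_iff.1 hy).2 x (hf.ne_top_of_mem hx)
    rw [hsub] at hx hy
    have a3 := (hf'.mem_hilbertSubdiff_iff.1 hx).2 y (hf'.ne_top_of_mem hy)
    have a4 := (hf'.mem_hilbertSubdiff_iff.1 hy).2 x (hf'.ne_top_of_mem hx)
    have e : ⟪g - k, x - y⟫ = - ⟪g, y - x⟫ - ⟪k, x - y⟫ := by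
      rw [inner_sub_left, ← neg_sub y x, inner_neg_right, inner_neg_right]
    rw [e, abs_le]
    constructor <;> linarith
  have hsq : ∀ x g y k, (x, g) ∈ hilbertSubdiff f → (y, k) ∈ hilbertSubdiff f →
      |((f' x).toReal - (f x).toReal) - ((f' y).toReal - (f y).toReal)|
        ≤ ‖(x + (1 : ℝ) • g) - (y + (1 : ℝ) • k)‖ ^ 2 := by
    intro x g y k hx hy
    refine (hmono x g y k hx hy).trans ?_
    have h0 := (abs_nonneg _).trans (hmono x g y k hx hy)
    have e : (x + (1 : ℝ) • g) - (y + (1 : ℝ) • k) = (g - k) + (x - y) := by module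
    rw [e, norm_add_sq_real]
    linarith [sq_nonneg ‖g - k‖, sq_nonneg ‖x - y‖]
  have hconst := eq_of_abs_sub_le_norm_sq (ψ := fun z => (f' (J z)).toReal - (f (J z)).toReal)
    (fun z w => by simpa only [hJz] using hsq _ _ _ _ (hJ z) (hJ w))
  refine ⟨(f' (J 0)).toReal - (f (J 0)).toReal, fun x g hx => ?_⟩
  have h1 := hsq x g _ _ hx (hJ (x + (1 : ℝ) • g))
  rw [hJz, sub_self, norm_zero, zero_pow two_ne_zero] at h1
  have h2 := abs_eq_zero.1 (le_antisymm h1 (abs_nonneg _))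
  have h3 := hconst (x + (1 : ℝ) • g) 0
  linarith

/-- The values of `f` are recovered from those on the domain of the subdifferential, along the
resolvents `(id + r ∂f)⁻¹ x → x` as `r → 0`. -/
theorem ConvexLsc.le_of_hilbertSubdiff_eq [CompleteSpace H] {f f' : H → EReal} (hf : ConvexLsc f)
    (hf' : ConvexLsc f') (hsub : hilbertSubdiff f = hilbertSubdiff f') {c : ℝ}
    (hc : ∀ x g, (x, g) ∈ hilbertSubdiff f → (f' x).toReal = (f x).toReal + c) (x : H) :
    f' x ≤ f x + c := by
  by_cases hx : f x = ⊤
  · simp [hx]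
  obtain ⟨a, b, hb, hab⟩ := hf.exists_linear_lower_bound x
  choose J G hJ hJz using fun n : ℕ =>
    hf.exists_resolvent (show 0 < 1 / ((n : ℝ) + 1) by positivity) x
  have hn : ∀ n, x - J n = (1 / ((n : ℝ) + 1)) • G n := fun n => by
    rw [sub_eq_iff_eq_add', hJz]
  have hsubg : ∀ n : ℕ, (f (J n)).toReal + ((n : ℝ) + 1) * ‖J n - x‖ ^ 2 ≤ (f x).toReal := by
    intro n
    have h1 := (hf.mem_hilbertSubdiff_iff.1 (hJ n)).2 x hx
    have h2 : G n = ((n : ℝ) + 1) • (x - J n) := by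
      rw [hn, smul_smul, mul_one_div_cancel (by positivity), one_smul]
    rwa [h2, real_inner_smul_left, real_inner_self_eq_norm_sq, norm_sub_rev] at h1
  have hJx : Tendsto J atTop (𝓝 x) := by
    rw [tendsto_iff_norm_sub_tendsto_zero]
    set K := (f x).toReal - a + b ^ 2 with hK
    -- The resolvent inequality beats the linear lower bound as the parameter `1 / (n + 1)` tends
    -- to zero.
    have hbound : ∀ n : ℕ, ‖J n - x‖ ^ 2 ≤ K / ((n : ℝ) + 1 / 2) := by
      intro n
      have h1 := hsubg n
      have h2 := hab _ (hf.ne_top_of_mem (hJ n))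
      have h3 : b * ‖J n - x‖ ≤ b ^ 2 + 1 / 2 * ‖J n - x‖ ^ 2 := by
        nlinarith [sq_nonneg (b - 1 / 2 * ‖J n - x‖), sq_nonneg ‖J n - x‖]
      rw [le_div_iff₀ (by positivity)]
      linarith
    have h1 : Tendsto (fun n => ‖J n - x‖ ^ 2) atTop (𝓝 0) :=
      squeeze_zero (fun n => by positivity) hbound
        ((tendsto_atTop_add_const_right _ _ tendsto_natCast_atTop_atTop).const_div_atTop K)
    simpa [Real.sqrt_sq] using h1.sqrt
  have hle : ∀ n, f' (J n) ≤ f x + c := by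
    intro n
    have h1 := hsubg n
    have h2 := hc _ _ (hJ n)
    have ht : f' (J n) ≠ ⊤ := by
      have := hJ n; rw [hsub] at this; exact hf'.ne_top_of_mem this
    rw [← hf'.coe_toReal ht, ← hf.coe_toReal hx]
    have : 0 ≤ ((n : ℝ) + 1) * ‖J n - x‖ ^ 2 := by positivity
    have h3 : (f' (J n)).toReal ≤ (f x).toReal + c := by linarith
    exact_mod_cast h3
  by_contra! hlt
  obtain ⟨n, hn⟩ := (hJx.eventually (hf'.lsc x _ hlt)).exists
  exact absurd (hle n) hn.not_ge

/-- A lower semi-continuous, proper, convex function is determined by its subdifferential up to an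
additive constant. -/
theorem ConvexLsc.exists_eq_add_const [CompleteSpace H] {f f' : H → EReal} (hf : ConvexLsc f)
    (hf' : ConvexLsc f') (hsub : hilbertSubdiff f = hilbertSubdiff f') :
    ∃ c : ℝ, ∀ x, f' x = f x + c := by
  obtain ⟨c, hc⟩ := hf.exists_const_on_domain hf' hsub
  refine ⟨c, fun x => le_antisymm (hf.le_of_hilbertSubdiff_eq hf' hsub hc x) ?_⟩
  have h := hf'.le_of_hilbertSubdiff_eq hf hsub.symm (c := -c)
    (fun y g hy => by rw [hc y g (hsub ▸ hy)]; ring) x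
  calc f x + c ≤ f' x + ((-c : ℝ) : EReal) + c := by gcongr
    _ = f' x := by
      rw [add_assoc, ← EReal.coe_add, neg_add_cancel, EReal.coe_zero, add_zero]

end Hilbert

/-! ### Transport on the unit interval -/

section Transfer

open Filter Topology Set ProbabilityTheory

/-- Every Borel probability measure on a standard Borel space is the law of a random variable on
`(0, 1)`. -/
theorem exists_map_unifMeasure_eq {Y : Type*} [MeasurableSpace Y] [StandardBorelSpace Y]
    (μ : Measure Y) [IsProbabilityMeasure μ] :
    ∃ φ : ℝ → Y, Measurable φ ∧ unifMeasure.map φ = μ := by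
  have : Nonempty Y := μ.nonempty_of_neZero
  obtain ⟨f, hf, hfμ⟩ := μ.exists_measurable_map_eq
  have hp : Measurable (projIcc (0 : ℝ) 1 zero_le_one) := continuous_projIcc.measurable
  refine ⟨f ∘ projIcc 0 1 zero_le_one, hf.comp hp, ?_⟩
  rw [← Measure.map_map hf hp, unifMeasure, Measure.restrict_congr_set Ioo_ae_eq_Icc,
    ← unitInterval.measurePreserving_coe.map_eq, Measure.map_map hp measurable_subtype_coe]
  have : projIcc (0 : ℝ) 1 zero_le_one ∘ (fun x : unitInterval => (x : ℝ)) = id := by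
    funext x; exact projIcc_val _ x
  rw [this, Measure.map_id, hfμ]

theorem continuous_cdf (μ : Measure ℝ) [IsProbabilityMeasure μ] (hμ : ∀ x, μ {x} = 0) :
    Continuous (cdf μ) := by
  rw [continuous_iff_continuousAt]
  intro x
  rw [(monotone_cdf μ).continuousAt_iff_leftLim_eq_rightLim, StieltjesFunction.rightLim_eq]
  have h1 := StieltjesFunction.measure_singleton (cdf μ) x
  rw [measure_cdf, hμ, eq_comm, ENNReal.ofReal_eq_zero, sub_nonpos] at h1
  exact le_antisymm ((monotone_cdf μ).leftLim_le le_rfl) h1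

theorem unifMeasure_Iic {a : ℝ} (h1 : a ≤ 1) :
    unifMeasure (Iic a) = ENNReal.ofReal a := by
  rw [unifMeasure, Measure.restrict_congr_set Ioo_ae_eq_Icc, Measure.restrict_apply measurableSet_Iic]
  have : Iic a ∩ Icc 0 1 = Icc 0 a := by
    ext x; simp only [mem_inter_iff, mem_Iic, mem_Icc]
    constructor
    · rintro ⟨h, h', -⟩; exact ⟨h', h⟩
    · rintro ⟨h, h'⟩; exact ⟨h', h, h'.trans h1⟩
  rw [this, Real.volume_Icc, sub_zero]

/-- The probability integral transform: an atomless law is transported to the uniform law by its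
distribution function. -/
theorem map_cdf_eq_unifMeasure (μ : Measure ℝ) [IsProbabilityMeasure μ] (hμ : ∀ x, μ {x} = 0) :
    μ.map (cdf μ) = unifMeasure := by
  have hcont := continuous_cdf μ hμ
  have hm : Measurable (cdf μ) := hcont.measurable
  have : IsProbabilityMeasure (μ.map (cdf μ)) := Measure.isProbabilityMeasure_map hm.aemeasurable
  have hivt : ∀ b ∈ Ioo (0 : ℝ) 1, ∃ x, cdf μ x = b := by
    intro b hb
    obtain ⟨u, hu⟩ := ((tendsto_cdf_atBot μ).eventually (gt_mem_nhds hb.1)).exists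
    obtain ⟨v, hv⟩ := ((tendsto_cdf_atTop μ).eventually (lt_mem_nhds hb.2)).exists
    exact mem_range_of_exists_le_of_exists_ge hcont ⟨u, hu.le⟩ ⟨v, hv.le⟩
  have hle : ∀ a b : ℝ, b ∈ Ioo (0 : ℝ) 1 → a < b → μ (cdf μ ⁻¹' Iic a) ≤ ENNReal.ofReal b := by
    intro a b hb hab
    obtain ⟨x, hx⟩ := hivt b hb
    rw [← hx, ofReal_cdf]
    refine measure_mono fun y hy => ?_
    by_contra hlt
    simp only [mem_Iic, not_le] at hlt
    have h1 := monotone_cdf μ hlt.le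
    simp only [mem_preimage, mem_Iic] at hy
    linarith
  refine Measure.ext_of_Iic _ _ fun a => ?_
  rw [Measure.map_apply hm measurableSet_Iic]
  rcases lt_or_ge a 1 with ha1 | ha1
  · rcases le_or_gt a 0 with ha0 | ha0
    · have h1 : unifMeasure (Iic a) = 0 := by
        refine le_antisymm ?_ zero_le
        calc unifMeasure (Iic a) ≤ unifMeasure (Iic 0) := measure_mono (Iic_subset_Iic.2 ha0)
          _ = 0 := by rw [unifMeasure_Iic zero_le_one, ENNReal.ofReal_zero]
      rw [h1]
      refine le_antisymm ?_ zero_le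
      have h2 : Tendsto (fun b : ℝ => ENNReal.ofReal b) (𝓝[>] 0) (𝓝 (ENNReal.ofReal 0)) :=
        (ENNReal.continuous_ofReal.tendsto 0).mono_left nhdsWithin_le_nhds
      rw [ENNReal.ofReal_zero] at h2
      refine ge_of_tendsto h2 ?_
      filter_upwards [Ioo_mem_nhdsGT (zero_lt_one' ℝ)] with b hb
      exact hle a b hb (ha0.trans_lt hb.1)
    · rw [unifMeasure_Iic ha1.le]
      refine le_antisymm ?_ ?_
      · have h2 : Tendsto (fun b : ℝ => ENNReal.ofReal b) (𝓝[>] a) (𝓝 (ENNReal.ofReal a)) :=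
          (ENNReal.continuous_ofReal.tendsto a).mono_left nhdsWithin_le_nhds
        refine ge_of_tendsto h2 ?_
        filter_upwards [Ioo_mem_nhdsGT ha1] with b hb
        exact hle a b ⟨ha0.trans hb.1, hb.2⟩ hb.1
      · obtain ⟨x, hx⟩ := hivt a ⟨ha0, ha1⟩
        rw [← hx, ofReal_cdf]
        exact measure_mono fun y hy => monotone_cdf μ hy
  · have h1 : cdf μ ⁻¹' Iic a = univ :=
      eq_univ_of_forall fun x => (cdf_le_one μ x).trans ha1
    rw [h1, measure_univ]
    refine le_antisymm ?_ prob_le_one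
    calc 1 = unifMeasure (Iic 1) := by
          rw [unifMeasure_Iic le_rfl, ENNReal.ofReal_one]
      _ ≤ _ := measure_mono (Iic_subset_Iic.2 ha1)

/-- Two events of equal probability can be transported to one another. -/
theorem exists_map_restrict_eq {A B : Set ℝ} (hAB : unifMeasure A = unifMeasure B) :
    ∃ τ : ℝ → ℝ, Measurable τ ∧ (unifMeasure.restrict A).map τ = unifMeasure.restrict B := by
  by_cases hA : unifMeasure A = 0
  · refine ⟨id, measurable_id, ?_⟩
    rw [Measure.restrict_eq_zero.2 hA, Measure.restrict_eq_zero.2 (hAB ▸ hA), Measure.map_zero]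
  · have hB : unifMeasure B ≠ 0 := hAB ▸ hA
    have : IsProbabilityMeasure (unifMeasure[|A]) := cond_isProbabilityMeasure hA
    have : IsProbabilityMeasure (unifMeasure[|B]) := cond_isProbabilityMeasure hB
    have hatom : ∀ x, unifMeasure[|A] {x} = 0 := fun x => by
      refine cond_absolutelyContinuous ?_
      exact measure_singleton x
    obtain ⟨φ, hφ, hφB⟩ := exists_map_unifMeasure_eq (unifMeasure[|B])
    have hm : Measurable (cdf unifMeasure[|A]) := (continuous_cdf _ hatom).measurable
    have h1 : (unifMeasure[|A]).map (φ ∘ cdf unifMeasure[|A]) = unifMeasure[|B] := by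
      rw [← Measure.map_map hφ hm, map_cdf_eq_unifMeasure _ hatom, hφB]
    refine ⟨_, hφ.comp hm, ?_⟩
    have h2 : ∀ C : Set ℝ, unifMeasure C ≠ 0 →
        unifMeasure.restrict C = unifMeasure C • unifMeasure[|C] := fun C hC => by
      rw [ProbabilityTheory.cond, smul_smul, ENNReal.mul_inv_cancel hC (measure_ne_top _ _),
        one_smul]
    rw [h2 A hA, h2 B hB, Measure.map_smul, h1, hAB]

/-- Two random variables on `(0, 1)` with the same law agree, up to a uniformly small error, after
composition of one of them with a measure preserving map. An exact identity can fail, since `Z`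
may generate the whole σ-algebra. -/
theorem exists_measurePreserving_abs_sub_le {Z W : ℝ → ℝ} (hZ : Measurable Z) (hW : Measurable W)
    (h : unifMeasure.map Z = unifMeasure.map W) {ε : ℝ} (hε : 0 < ε) :
    ∃ τ : ℝ → ℝ, MeasurePreserving τ unifMeasure unifMeasure ∧
      ∀ᵐ t ∂unifMeasure, |Z t - W (τ t)| ≤ ε := by
  -- Cut the line into cells of length `ε` and transport cell by cell.
  have hN : Measurable fun x : ℝ => ⌊x / ε⌋ := Int.measurable_floor.comp (measurable_id.div_const ε)
  set A : ℤ → Set ℝ := fun i => (fun t => ⌊Z t / ε⌋) ⁻¹' {i} with hAdef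
  set B : ℤ → Set ℝ := fun i => (fun t => ⌊W t / ε⌋) ⁻¹' {i} with hBdef
  have hA : ∀ i, MeasurableSet (A i) := fun i => (hN.comp hZ) (measurableSet_singleton i)
  have hB : ∀ i, MeasurableSet (B i) := fun i => (hN.comp hW) (measurableSet_singleton i)
  have hAB : ∀ i, unifMeasure (A i) = unifMeasure (B i) := fun i => by
    have hS : MeasurableSet ((fun x : ℝ => ⌊x / ε⌋) ⁻¹' {i}) := hN (measurableSet_singleton i)
    have h1 := Measure.map_apply (μ := unifMeasure) hZ hS
    have h2 := Measure.map_apply (μ := unifMeasure) hW hS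
    rw [h, h2] at h1
    exact h1.symm
  have hsum : ∀ {V : ℝ → ℝ}, Measurable V →
      Measure.sum (fun i : ℤ => unifMeasure.restrict ((fun t => ⌊V t / ε⌋) ⁻¹' {i}))
        = unifMeasure := by
    intro V hV
    rw [← Measure.restrict_iUnion (pairwise_disjoint_fiber fun t => ⌊V t / ε⌋)
      (fun i => (hN.comp hV) (measurableSet_singleton i)), ← preimage_iUnion, iUnion_of_singleton,
      preimage_univ, Measure.restrict_univ]
  choose T hT hTmap using fun i => exists_map_restrict_eq (hAB i)
  have hτ : Measurable fun t => T ⌊Z t / ε⌋ t := by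
    have h1 : Measurable fun p : ℤ × ℝ => T p.1 p.2 :=
      measurable_from_prod_countable_right fun i => hT i
    exact h1.comp ((hN.comp hZ).prodMk measurable_id)
  have hae : ∀ i, (fun t => T ⌊Z t / ε⌋ t) =ᵐ[unifMeasure.restrict (A i)] T i := fun i => by
    filter_upwards [ae_restrict_mem (hA i)] with t ht
    rw [mem_preimage, mem_singleton_iff] at ht
    rw [ht]
  refine ⟨_, ⟨hτ, ?_⟩, ?_⟩
  · conv_lhs => rw [← hsum hZ]
    rw [Measure.map_sum hτ.aemeasurable]
    conv_rhs => rw [← hsum hW]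
    congr 1
    funext i
    rw [Measure.map_congr (hae i), hTmap]
  · have h1 : ∀ i, ∀ᵐ t ∂unifMeasure, t ∈ A i → T i t ∈ B i := fun i => by
      rw [← ae_restrict_iff' (hA i)]
      refine ae_of_ae_map (hT i).aemeasurable ?_
      rw [hTmap]
      exact ae_restrict_mem (hB i)
    filter_upwards [ae_all_iff.2 h1] with t ht
    have h2 : ⌊W (T ⌊Z t / ε⌋ t) / ε⌋ = ⌊Z t / ε⌋ := ht ⌊Z t / ε⌋ rfl
    have h3 := Int.abs_sub_lt_one_of_floor_eq_floor h2.symm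
    rw [← sub_div, abs_div, abs_of_pos hε, div_lt_one hε] at h3
    exact h3.le

end Transfer

/-! ### Laws of elements of `L₂(0, 1)` -/

section Laws

open Filter Topology Set ProbabilityTheory
open scoped RealInnerProductSpace

theorem measurable_coeFn (X : L2) : Measurable X :=
  (Lp.stronglyMeasurable X).measurable

theorem inner_eq_integral (X G : L2) : ⟪X, G⟫ = ∫ t, X t * G t ∂unifMeasure := by
  rw [L2.inner_def]
  exact integral_congr_ae (Eventually.of_forall fun t => by simp [mul_comm])

theorem inner_eq_integral_jointLaw (X G : L2) :
    ⟪X, G⟫ = ∫ p, p.1 * p.2 ∂(jointLaw X G).toMeasure := by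
  have h : (jointLaw X G).toMeasure = unifMeasure.map fun t => (X t, G t) := rfl
  rw [inner_eq_integral, h, integral_map
    ((measurable_coeFn X).prodMk (measurable_coeFn G)).aemeasurable
    (show Continuous fun p : ℝ × ℝ => p.1 * p.2 by fun_prop).aestronglyMeasurable]

theorem inner_eq_of_jointLaw_eq {X G Y K : L2} (h : jointLaw X G = jointLaw Y K) :
    ⟪X, G⟫ = ⟪Y, K⟫ := by
  rw [inner_eq_integral_jointLaw, inner_eq_integral_jointLaw, h]

theorem map_fst_jointLaw (X G : L2) : (jointLaw X G).toMeasure.map Prod.fst = (law X).toMeasure :=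
  Measure.map_map measurable_fst ((measurable_coeFn X).prodMk (measurable_coeFn G))

theorem map_snd_jointLaw (X G : L2) : (jointLaw X G).toMeasure.map Prod.snd = (law G).toMeasure :=
  Measure.map_map measurable_snd ((measurable_coeFn X).prodMk (measurable_coeFn G))

theorem law_fst_eq_of_jointLaw_eq {X G Y K : L2} (h : jointLaw X G = jointLaw Y K) :
    law X = law Y :=
  P2.ext (by rw [← map_fst_jointLaw X G, h, map_fst_jointLaw])

theorem law_snd_eq_of_jointLaw_eq {X G Y K : L2} (h : jointLaw X G = jointLaw Y K) :
    law G = law K :=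
  P2.ext (by rw [← map_snd_jointLaw X G, h, map_snd_jointLaw])

theorem norm_eq_of_law_eq {X Y : L2} (h : law X = law Y) : ‖X‖ = ‖Y‖ := by
  have key : ∀ Z : L2, ‖Z‖ ^ 2 = ∫ x, x * x ∂(law Z).toMeasure := fun Z => by
    have h : (law Z).toMeasure = unifMeasure.map Z := rfl
    rw [← real_inner_self_eq_norm_sq, inner_eq_integral, h, integral_map
      (measurable_coeFn Z).aemeasurable (show Continuous fun x : ℝ => x * x by fun_prop).aestronglyMeasurable]
  have h2 : ‖X‖ ^ 2 = ‖Y‖ ^ 2 := by rw [key, key, h]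
  exact (pow_left_inj₀ (norm_nonneg _) (norm_nonneg _) two_ne_zero).1 h2

/-- Composition with a measure preserving map of `(0, 1)`, as an isometry of `L₂(0, 1)`. -/
abbrev pull (τ : ℝ → ℝ) (hτ : MeasurePreserving τ unifMeasure unifMeasure) : L2 →ₗᵢ[ℝ] L2 :=
  Lp.compMeasurePreservingₗᵢ ℝ τ hτ

theorem coeFn_pull {τ : ℝ → ℝ} (hτ : MeasurePreserving τ unifMeasure unifMeasure) (X : L2) :
    pull τ hτ X =ᵐ[unifMeasure] X ∘ τ :=
  Lp.coeFn_compMeasurePreserving X hτ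

theorem jointLaw_pull {τ : ℝ → ℝ} (hτ : MeasurePreserving τ unifMeasure unifMeasure) (X G : L2) :
    jointLaw (pull τ hτ X) (pull τ hτ G) = jointLaw X G := by
  refine P2.ext ?_
  change unifMeasure.map (fun t => (pull τ hτ X t, pull τ hτ G t)) =
    unifMeasure.map fun t => (X t, G t)
  have h1 : (fun t => (pull τ hτ X t, pull τ hτ G t)) =ᵐ[unifMeasure]
      (fun t => (X t, G t)) ∘ τ := by
    filter_upwards [coeFn_pull hτ X, coeFn_pull hτ G] with t h1 h2
    exact Prod.ext h1 h2
  rw [Measure.map_congr h1, ← Measure.map_map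
    ((measurable_coeFn X).prodMk (measurable_coeFn G)) hτ.measurable, hτ.map_eq]

theorem law_pull {τ : ℝ → ℝ} (hτ : MeasurePreserving τ unifMeasure unifMeasure) (X : L2) :
    law (pull τ hτ X) = law X :=
  law_fst_eq_of_jointLaw_eq (jointLaw_pull hτ X X)

/-- Elements of `L₂(0, 1)` with the same law are arbitrarily close up to a measure preserving
change of variables. -/
theorem exists_norm_sub_pull_le {X Y : L2} (h : law X = law Y) {ε : ℝ} (hε : 0 < ε) :
    ∃ (τ : ℝ → ℝ) (hτ : MeasurePreserving τ unifMeasure unifMeasure),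
      ‖X - pull τ hτ Y‖ ≤ ε := by
  obtain ⟨τ, hτ, hle⟩ := exists_measurePreserving_abs_sub_le (measurable_coeFn X)
    (measurable_coeFn Y) (congrArg P2.toMeasure h) hε
  refine ⟨τ, hτ, ?_⟩
  have h1 := Lp.norm_le_of_ae_bound (f := X - pull τ hτ Y) hε.le (by
    filter_upwards [hle, Lp.coeFn_sub X (pull τ hτ Y), coeFn_pull hτ Y] with t h1 h2 h3
    rw [h2, Pi.sub_apply, h3, Real.norm_eq_abs]
    exact h1)
  have h2 : measureUnivNNReal unifMeasure = 1 := by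
    rw [← ENNReal.coe_inj, coe_measureUnivNNReal, measure_univ, ENNReal.coe_one]
  simpa [h2] using h1

/-- A finite family of square-integrable random variables on any probability space has a copy in
`L₂(0, 1)` with the same two-dimensional marginals. -/
theorem exists_L2_family {ι Ω : Type*} [Fintype ι] [MeasurableSpace Ω] (P : Measure Ω)
    [IsProbabilityMeasure P] (V : ι → Ω → ℝ) (hV : ∀ i, MemLp (V i) 2 P) :
    ∃ Y : ι → L2, ∀ i j, (jointLaw (Y i) (Y j)).toMeasure = P.map fun ω => (V i ω, V j ω) := by
  have hVm : AEMeasurable (fun ω i => V i ω) P :=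
    aemeasurable_pi_lambda _ fun i => (hV i).1.aemeasurable
  have : IsProbabilityMeasure (P.map fun ω i => V i ω) := Measure.isProbabilityMeasure_map hVm
  obtain ⟨φ, hφ, hφV⟩ := exists_map_unifMeasure_eq (P.map fun ω i => V i ω)
  have hφi : ∀ i, Measurable fun t => φ t i := fun i => (measurable_pi_apply i).comp hφ
  have hpair : ∀ i j, unifMeasure.map (fun t => (φ t i, φ t j)) =
      P.map fun ω => (V i ω, V j ω) := by
    intro i j
    have hm : Measurable fun x : ι → ℝ => (x i, x j) :=
      (measurable_pi_apply i).prodMk (measurable_pi_apply j)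
    have h1 := AEMeasurable.map_map_of_aemeasurable hm.aemeasurable hVm
    rw [← hφV, Measure.map_map hm hφ] at h1
    exact h1
  have hone : ∀ i, unifMeasure.map (fun t => φ t i) = P.map (V i) := by
    intro i
    have h1 := congrArg (fun m => Measure.map Prod.fst m) (hpair i i)
    rwa [Measure.map_map measurable_fst ((hφi i).prodMk (hφi i)),
      AEMeasurable.map_map_of_aemeasurable measurable_fst.aemeasurable
        ((hV i).1.aemeasurable.prodMk (hV i).1.aemeasurable)] at h1
  have hmem : ∀ i, MemLp (fun t => φ t i) 2 unifMeasure := by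
    intro i
    have h1 := (memLp_map_measure_iff aestronglyMeasurable_id (hV i).1.aemeasurable).2
      (show MemLp (id ∘ V i) 2 P from hV i)
    rw [← hone] at h1
    exact (memLp_map_measure_iff aestronglyMeasurable_id (hφi i).aemeasurable).1 h1
  refine ⟨fun i => (hmem i).toLp _, fun i j => ?_⟩
  rw [← hpair]
  refine Measure.map_congr ?_
  filter_upwards [(hmem i).coeFn_toLp, (hmem j).coeFn_toLp] with t h1 h2
  rw [h1, h2]

theorem exists_jointLaw_eq_of_memLp (π : Measure (ℝ × ℝ)) [IsProbabilityMeasure π]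
    (h1 : MemLp (fun p : ℝ × ℝ => p.1) 2 π) (h2 : MemLp (fun p : ℝ × ℝ => p.2) 2 π) :
    ∃ X G : L2, (jointLaw X G).toMeasure = π := by
  obtain ⟨Y, hY⟩ := exists_L2_family π (fun (b : Bool) p => if b then p.1 else p.2)
    (fun b => by cases b <;> simpa)
  refine ⟨Y true, Y false, ?_⟩
  rw [hY]
  simp

theorem P2.memLp_fst (π : P2 (ℝ × ℝ)) : MemLp (fun p : ℝ × ℝ => p.1) 2 π.toMeasure := π.memLp_id.fst

theorem P2.memLp_snd (π : P2 (ℝ × ℝ)) : MemLp (fun p : ℝ × ℝ => p.2) 2 π.toMeasure := π.memLp_id.snd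

theorem exists_jointLaw_eq (π : P2 (ℝ × ℝ)) : ∃ X G : L2, jointLaw X G = π := by
  obtain ⟨X, G, h⟩ := exists_jointLaw_eq_of_memLp π.toMeasure π.memLp_fst π.memLp_snd
  exact ⟨X, G, P2.ext h⟩

theorem exists_law_eq (μ : P2 ℝ) : ∃ X : L2, law X = μ := by
  obtain ⟨Y, hY⟩ := exists_L2_family μ.toMeasure (fun (_ : Unit) x => x) fun _ => μ.memLp_id
  refine ⟨Y (), P2.ext ?_⟩
  rw [← map_fst_jointLaw (Y ()) (Y ()), hY, Measure.map_map measurable_fst (by fun_prop)]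
  exact Measure.map_id

/-! ### Couplings and the Wasserstein distance through random variables on `(0, 1)` -/

theorem isCoupling_jointLaw (X Y : L2) : IsCoupling (jointLaw X Y).toMeasure (law X) (law Y) :=
  ⟨map_fst_jointLaw X Y, map_snd_jointLaw X Y⟩

theorem IsCoupling.exists_jointLaw_eq {π : Measure (ℝ × ℝ)} {μ ν : P2 ℝ} (h : IsCoupling π μ ν) :
    ∃ X Y : L2, (jointLaw X Y).toMeasure = π ∧ law X = μ ∧ law Y = ν := by
  have := h.isProbabilityMeasure
  obtain ⟨X, Y, hXY⟩ := exists_jointLaw_eq_of_memLp π h.memLp_fst h.memLp_snd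
  refine ⟨X, Y, hXY, P2.ext ?_, P2.ext ?_⟩
  · rw [← map_fst_jointLaw X Y, hXY, h.fst_eq]
  · rw [← map_snd_jointLaw X Y, hXY, h.snd_eq]

theorem interp_jointLaw {π : Measure (ℝ × ℝ)} {μ ν : P2 ℝ} (h : IsCoupling π μ ν) {X Y : L2}
    (hXY : (jointLaw X Y).toMeasure = π) (α : ℝ) :
    interp h α = law (α • X + (1 - α) • Y) := by
  refine P2.ext ?_
  change π.map (fun p : ℝ × ℝ => α * p.1 + (1 - α) * p.2) =
    unifMeasure.map (α • X + (1 - α) • Y : L2)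
  rw [← hXY]
  change (unifMeasure.map fun t => (X t, Y t)).map _ = _
  rw [Measure.map_map (by fun_prop) ((measurable_coeFn X).prodMk (measurable_coeFn Y))]
  refine Measure.map_congr ?_
  filter_upwards [Lp.coeFn_add (α • X) ((1 - α) • Y), Lp.coeFn_smul α X,
    Lp.coeFn_smul (1 - α) Y] with t h1 h2 h3
  rw [h1, Pi.add_apply, h2, h3]
  rfl

theorem norm_sub_sq_eq_integral (X Y : L2) :
    ‖X - Y‖ ^ 2 = ∫ p, (p.1 - p.2) ^ 2 ∂(jointLaw X Y).toMeasure := by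
  have h : (jointLaw X Y).toMeasure = unifMeasure.map fun t => (X t, Y t) := rfl
  rw [← real_inner_self_eq_norm_sq, inner_eq_integral, h, integral_map
    ((measurable_coeFn X).prodMk (measurable_coeFn Y)).aemeasurable
    (show Continuous fun p : ℝ × ℝ => (p.1 - p.2) ^ 2 by fun_prop).aestronglyMeasurable]
  refine integral_congr_ae ?_
  filter_upwards [Lp.coeFn_sub X Y] with t ht
  simp only [ht, Pi.sub_apply]
  ring

theorem W2_law_le (X Y : L2) : W2 (law X) (law Y) ≤ ‖X - Y‖ := by
  refine Real.sqrt_le_iff.2 ⟨norm_nonneg _, csInf_le ⟨0, ?_⟩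
    ⟨_, isCoupling_jointLaw X Y, norm_sub_sq_eq_integral X Y⟩⟩
  rintro _ ⟨π, -, rfl⟩
  exact integral_nonneg fun p => sq_nonneg _

theorem exists_norm_sub_lt_of_W2_lt {μ ν : P2 ℝ} {δ : ℝ} (h : W2 μ ν < δ) :
    ∃ X Y : L2, law X = μ ∧ law Y = ν ∧ ‖X - Y‖ < δ := by
  have hδ : 0 < δ := (Real.sqrt_nonneg _).trans_lt h
  obtain ⟨X₀, hX₀⟩ := exists_law_eq μ
  obtain ⟨Y₀, hY₀⟩ := exists_law_eq ν
  have hne : {c : ℝ | ∃ π : Measure (ℝ × ℝ),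
      IsCoupling π μ ν ∧ c = ∫ p, (p.1 - p.2) ^ 2 ∂π}.Nonempty :=
    ⟨_, _, hX₀ ▸ hY₀ ▸ isCoupling_jointLaw X₀ Y₀, rfl⟩
  obtain ⟨_, ⟨π, hπ, rfl⟩, hlt⟩ := exists_lt_of_csInf_lt hne ((Real.sqrt_lt' hδ).1 h)
  obtain ⟨X, Y, hXY, hX, hY⟩ := hπ.exists_jointLaw_eq
  refine ⟨X, Y, hX, hY, ?_⟩
  rw [← hXY, ← norm_sub_sq_eq_integral] at hlt
  exact lt_of_pow_lt_pow_left₀ 2 hδ.le hlt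

theorem continuous_law : Continuous law := by
  rw [continuous_def]
  intro U hU
  rw [Metric.isOpen_iff]
  intro X hX
  obtain ⟨ε, hε, h⟩ := hU (law X) hX
  refine ⟨ε, hε, fun Y hY => h _ ((W2_law_le X Y).trans_lt ?_)⟩
  rwa [Metric.mem_ball, dist_comm, dist_eq_norm] at hY

/-! ### The correspondence between the two function spaces -/

theorem ConvexP2.symmConvexL2_comp_law {F : P2 ℝ → EReal} (hF : ConvexP2 F) :
    SymmConvexL2 fun X => F (law X) where
  lsc := hF.lsc.comp continuous_law
  proper := by
    obtain ⟨μ, hμ⟩ := hF.proper.2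
    obtain ⟨X, rfl⟩ := exists_law_eq μ
    exact ⟨fun X => hF.proper.1 _, X, hμ⟩
  symmetric := fun X X' h => by rw [h]
  convex := fun X X' α h0 h1 => by
    rw [← interp_jointLaw (isCoupling_jointLaw X X') rfl]
    exact hF.convex _ _ _ _ α h0 h1

/-- Lower semi-continuity for `W₂`: a coupling of `law X` with a nearby measure need not involve `X`
itself, but a measure preserving change of variables moves it close to `X`. -/
theorem SymmConvexL2.convexP2_of_comp_law {F : P2 ℝ → EReal}
    (hF : SymmConvexL2 fun X => F (law X)) : ConvexP2 F where
  lsc := by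
    rw [lowerSemicontinuous_iff_isOpen_preimage]
    intro a μ hμ
    obtain ⟨X, rfl⟩ := exists_law_eq μ
    obtain ⟨δ, hδ, h⟩ := Metric.eventually_nhds_iff.1 (hF.lsc X a hμ)
    refine ⟨δ, hδ, fun ν hν => ?_⟩
    obtain ⟨X', Y', hX', rfl, hlt⟩ := exists_norm_sub_lt_of_W2_lt hν
    obtain ⟨τ, hτ, hle⟩ := exists_norm_sub_pull_le hX'.symm
      (show 0 < (δ - ‖X' - Y'‖) / 2 by linarith)
    have h1 : dist (pull τ hτ Y') X < δ := by
      have h2 : ‖X - pull τ hτ Y'‖ ≤ ‖X - pull τ hτ X'‖ + ‖pull τ hτ X' - pull τ hτ Y'‖ :=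
        norm_sub_le_norm_sub_add_norm_sub _ _ _
      rw [← map_sub, LinearIsometry.norm_map] at h2
      rw [dist_comm, dist_eq_norm]
      linarith
    have h3 : a < F (law (pull τ hτ Y')) := h h1
    rwa [law_pull] at h3
  proper := by
    obtain ⟨h1, X, hX⟩ := hF.proper
    refine ⟨fun μ => ?_, _, hX⟩
    obtain ⟨Y, rfl⟩ := exists_law_eq μ
    exact h1 Y
  convex := fun μ ν π h α h0 h1 => by
    obtain ⟨X, Y, hXY, rfl, rfl⟩ := h.exists_jointLaw_eq
    rw [interp_jointLaw h hXY]
    exact hF.convex X Y α h0 h1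

theorem SymmConvexL2.convexLsc {f : L2 → EReal} (hf : SymmConvexL2 f) : ConvexLsc f :=
  ⟨hf.lsc, hf.proper.1, hf.proper.2, hf.convex⟩

theorem subdiff_eq_hilbertSubdiff (f : L2 → EReal) : subdiff f = hilbertSubdiff f := by
  have key : ∀ X G X' : L2, ∫ t, G t * (X' t - X t) ∂unifMeasure = ⟪G, X' - X⟫ := by
    intro X G X'
    rw [inner_eq_integral]
    refine integral_congr_ae ?_
    filter_upwards [Lp.coeFn_sub X' X] with t ht
    rw [ht, Pi.sub_apply]
  ext ⟨X, G⟩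
  simp only [subdiff, hilbertSubdiff, key]

/-- The subdifferential of a symmetric convex function is determined by its joint laws. -/
theorem SymmConvexL2.mem_subdiff_of_jointLaw_eq {f : L2 → EReal} (hf : SymmConvexL2 f)
    {X G Y K : L2} (hXG : (X, G) ∈ subdiff f) (h : jointLaw Y K = jointLaw X G) :
    (Y, K) ∈ subdiff f := by
  rw [subdiff_eq_hilbertSubdiff, hf.convexLsc.mem_hilbertSubdiff_iff] at hXG ⊢
  obtain ⟨hX, hsub⟩ := hXG
  have hfY : f Y = f X := hf.symmetric Y X (law_fst_eq_of_jointLaw_eq h)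
  refine ⟨hfY ▸ hX, fun X' hX' => ?_⟩
  refine le_of_forall_pos_le_add fun ε hε => ?_
  -- Test the subgradient inequality at `(X, G)` against a rearrangement `X' ∘ τ` that sits
  -- relative to `G` almost as `X'` sits relative to `K`.
  obtain ⟨τ, hτ, hle⟩ := exists_norm_sub_pull_le (law_snd_eq_of_jointLaw_eq h).symm
    (show 0 < ε / (‖X'‖ + 1) by positivity)
  have hfτ : f (pull τ hτ X') = f X' := hf.symmetric _ _ (law_pull hτ X')
  have h1 := hsub (pull τ hτ X') (hfτ ▸ hX')
  have h2 : |⟪G - pull τ hτ K, pull τ hτ X'⟫| ≤ ε := by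
    refine (abs_real_inner_le_norm _ _).trans ?_
    rw [LinearIsometry.norm_map]
    calc ‖G - pull τ hτ K‖ * ‖X'‖ ≤ ε / (‖X'‖ + 1) * (‖X'‖ + 1) := by gcongr; linarith
      _ = ε := div_mul_cancel₀ _ (by positivity)
  have h3 : ⟪pull τ hτ K, pull τ hτ X'⟫ = ⟪K, X'⟫ := LinearIsometry.inner_map_map _ _ _
  have h4 := inner_eq_of_jointLaw_eq h
  rw [hfτ, inner_sub_right] at h1
  rw [inner_sub_left, h3] at h2
  rw [real_inner_comm, real_inner_comm G X] at h4
  rw [hfY, inner_sub_right, h4]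
  have h5 := (abs_le.1 h2).1
  linarith

theorem SymmConvexL2.jointLaw_mem_wassSubdiffL2_iff {f : L2 → EReal} (hf : SymmConvexL2 f)
    {X G : L2} : jointLaw X G ∈ wassSubdiffL2 f ↔ (X, G) ∈ subdiff f :=
  ⟨fun ⟨_, _, h, h'⟩ => hf.mem_subdiff_of_jointLaw_eq h h'.symm, fun h => ⟨X, G, h, rfl⟩⟩

/-! ### Subdifferentials are maximally jointly cyclically monotone -/

/-- The random vector is moved to `(0, 1)`, where the subgradient inequalities add up. -/
theorem SymmConvexL2.jointlyCyclicallyMonotone {f : L2 → EReal} (hf : SymmConvexL2 f) :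
    JointlyCyclicallyMonotone (wassSubdiffL2 f) := by
  intro n π hπ Ω _ P _ X G hX hG hXG σ
  have hmem : ∀ j, MemLp (fun ω => (X j ω, G j ω)) 2 P := fun j => by
    have h1 := (π j).memLp_id
    rw [← hXG] at h1
    exact (memLp_map_measure_iff aestronglyMeasurable_id ((hX j).prodMk (hG j))).1 h1
  obtain ⟨Y, hY⟩ := exists_L2_family P (Sum.elim X G)
    (Sum.rec (fun j => (hmem j).fst) fun j => (hmem j).snd)
  have hinner : ∀ j k, ∫ ω, X j ω * G k ω ∂P = ⟪Y (.inl j), Y (.inr k)⟫ := by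
    intro j k
    rw [inner_eq_integral_jointLaw, hY]
    simp only [Sum.elim_inl, Sum.elim_inr]
    rw [integral_map ((hX j).prodMk (hG k))
      (show Continuous fun p : ℝ × ℝ => p.1 * p.2 by fun_prop).aestronglyMeasurable]
  have hsub : ∀ j, (Y (.inl j), Y (.inr j)) ∈ hilbertSubdiff f := by
    intro j
    rw [← subdiff_eq_hilbertSubdiff, ← hf.jointLaw_mem_wassSubdiffL2_iff]
    have : jointLaw (Y (.inl j)) (Y (.inr j)) = π j := P2.ext ((hY _ _).trans (hXG j))
    rw [this]
    exact hπ j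
  simp only [hinner]
  have h1 : ∀ j, ⟪Y (.inl j), Y (.inr (σ j))⟫ ≤
      (f (Y (.inl j))).toReal - (f (Y (.inl (σ j)))).toReal
        + ⟪Y (.inl (σ j)), Y (.inr (σ j))⟫ := by
    intro j
    have h := (hf.convexLsc.mem_hilbertSubdiff_iff.1 (hsub (σ j))).2 _
      (hf.convexLsc.ne_top_of_mem (hsub j))
    rw [inner_sub_right, real_inner_comm, real_inner_comm (Y (.inl (σ j)))] at h
    linarith
  refine (Finset.sum_le_sum fun j _ => h1 j).trans ?_
  rw [Finset.sum_add_distrib, Finset.sum_sub_distrib,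
    Equiv.sum_comp σ fun j => (f (Y (.inl j))).toReal,
    Equiv.sum_comp σ fun j => ⟪Y (.inl j), Y (.inr j)⟫]
  simp

/-- On `(0, 1)` itself, joint cyclic monotonicity reads as a statement on inner products. -/
theorem JointlyCyclicallyMonotone.sum_inner_le {R : Set (P2 (ℝ × ℝ))}
    (hR : JointlyCyclicallyMonotone R) {n : ℕ} (X G : Fin n → L2)
    (h : ∀ j, jointLaw (X j) (G j) ∈ R) (σ : Equiv.Perm (Fin n)) :
    ∑ j, ⟪X j, G (σ j)⟫ ≤ ∑ j, ⟪X j, G j⟫ := by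
  simp only [inner_eq_integral]
  exact hR n _ h ℝ unifMeasure (fun j => X j) (fun j => G j)
    (fun j => (measurable_coeFn _).aemeasurable) (fun j => (measurable_coeFn _).aemeasurable)
    (fun j => rfl) σ

theorem JointlyCyclicallyMonotone.inner_sub_sub_nonneg {R : Set (P2 (ℝ × ℝ))}
    (hR : JointlyCyclicallyMonotone R) {X G Y K : L2} (h1 : jointLaw X G ∈ R)
    (h2 : jointLaw Y K ∈ R) : 0 ≤ ⟪X - Y, G - K⟫ := by
  have h := hR.sum_inner_le ![X, Y] ![G, K] (by simp [Fin.forall_fin_two, h1, h2])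
    (Equiv.swap 0 1)
  simp only [Fin.sum_univ_two, Equiv.swap_apply_left, Equiv.swap_apply_right,
    Matrix.cons_val_zero, Matrix.cons_val_one] at h
  rw [inner_sub_left, inner_sub_right, inner_sub_right]
  linarith

/-- Maximality comes from Minty's theorem: for `law (X, G)` in a larger set, the solution `(Y, K)`
of `Y + K = X + G` in the subdifferential has to be `(X, G)`, by monotonicity. -/
theorem SymmConvexL2.maximallyJointlyCyclicallyMonotone {f : L2 → EReal} (hf : SymmConvexL2 f) :
    MaximallyJointlyCyclicallyMonotone (wassSubdiffL2 f) := by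
  refine ⟨hf.jointlyCyclicallyMonotone, fun S hS hsub => hsub.2 fun π hπ => ?_⟩
  obtain ⟨X, G, rfl⟩ := exists_jointLaw_eq π
  obtain ⟨Y, K, hYK, hsum⟩ := hf.convexLsc.exists_resolvent one_pos (X + G)
  rw [← subdiff_eq_hilbertSubdiff, ← hf.jointLaw_mem_wassSubdiffL2_iff] at hYK
  rw [one_smul] at hsum
  have h1 := hS.inner_sub_sub_nonneg hπ (hsub.1 hYK)
  have h2 : G - K = -(X - Y) := by
    rw [eq_comm, neg_sub, sub_eq_sub_iff_add_eq_add, hsum, add_comm]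
  rw [h2, inner_neg_right, real_inner_self_eq_norm_sq, neg_nonneg] at h1
  have h3 : X - Y = 0 := by
    rw [← norm_eq_zero]; exact pow_eq_zero_iff two_ne_zero |>.1 (le_antisymm h1 (sq_nonneg _))
  rw [h3, neg_zero] at h2
  rw [sub_eq_zero.1 h3, sub_eq_zero.1 h2]
  exact hYK

/-- A function in `𝓕` is determined by its Wasserstein subdifferential up to a constant. -/
theorem SymmConvexL2.exists_eq_add_const {f f' : L2 → EReal} (hf : SymmConvexL2 f)
    (hf' : SymmConvexL2 f') (h : wassSubdiffL2 f' = wassSubdiffL2 f) :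
    ∃ c : ℝ, ∀ X, f' X = f X + c := by
  refine hf.convexLsc.exists_eq_add_const hf'.convexLsc ?_
  rw [← subdiff_eq_hilbertSubdiff, ← subdiff_eq_hilbertSubdiff]
  ext ⟨X, G⟩
  rw [← hf.jointLaw_mem_wassSubdiffL2_iff, ← hf'.jointLaw_mem_wassSubdiffL2_iff, h]

end Laws

/-! ### Rockafellar's potential for joint laws -/

section Rockafellar

open Set
open scoped RealInnerProductSpace

/-- Sequences of pairs in `L₂(0, 1)` with joint laws in `R`, the first one with joint law `π₀`. The
starting pair itself is not prescribed: this is what makes `rockafellar` symmetric. -/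
structure IsChain (R : Set (P2 (ℝ × ℝ))) (π₀ : P2 (ℝ × ℝ)) (q : ℕ → L2 × L2) : Prop where
  zero : jointLaw (q 0).1 (q 0).2 = π₀
  mem : ∀ i, jointLaw (q i).1 (q i).2 ∈ R

/-- The value at `X` of the affine function obtained by adding up the subgradient inequalities
along the first `n + 1` members of `q`. -/
def chainValue (q : ℕ → L2 × L2) (n : ℕ) (X : L2) : ℝ :=
  ∑ i ∈ Finset.range n, ⟪(q i).2, (q (i + 1)).1 - (q i).1⟫ + ⟪(q n).2, X - (q n).1⟫

/-- Rockafellar's potential of `R`: the supremum over all chains from `π₀` to `X`. -/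
def rockafellar (R : Set (P2 (ℝ × ℝ))) (π₀ : P2 (ℝ × ℝ)) (X : L2) : EReal :=
  ⨆ p : ℕ × {q : ℕ → L2 × L2 // IsChain R π₀ q}, (chainValue p.2 p.1 X : EReal)

theorem le_rockafellar {R : Set (P2 (ℝ × ℝ))} {π₀ : P2 (ℝ × ℝ)} {q : ℕ → L2 × L2}
    (hq : IsChain R π₀ q) (n : ℕ) (X : L2) : (chainValue q n X : EReal) ≤ rockafellar R π₀ X :=
  le_iSup (fun p : ℕ × {q : ℕ → L2 × L2 // IsChain R π₀ q} => (chainValue p.2 p.1 X : EReal))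
    (n, ⟨q, hq⟩)

theorem chainValue_add_inner (q : ℕ → L2 × L2) (n : ℕ) (X Y : L2) :
    chainValue q n Y = chainValue q n X + ⟪(q n).2, Y - X⟫ := by
  rw [chainValue, chainValue, add_assoc, ← inner_add_right]
  congr 3
  abel

theorem chainValue_convex (q : ℕ → L2 × L2) (n : ℕ) (X Y : L2) (α : ℝ) :
    chainValue q n (α • X + (1 - α) • Y) =
      α * chainValue q n X + (1 - α) * chainValue q n Y := by
  rw [chainValue_add_inner q n X, chainValue_add_inner q n X Y]
  have : α • X + (1 - α) • Y - X = (1 - α) • (Y - X) := by module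
  rw [this, inner_smul_right]
  ring

/-- A closed chain has non-positive value: this is joint cyclic monotonicity for a cyclic
permutation. -/
theorem JointlyCyclicallyMonotone.chainValue_zero_le {R : Set (P2 (ℝ × ℝ))}
    (hR : JointlyCyclicallyMonotone R) {q : ℕ → L2 × L2} (n : ℕ)
    (hq : ∀ i, jointLaw (q i).1 (q i).2 ∈ R) : chainValue q n (q 0).1 ≤ 0 := by
  have h := hR.sum_inner_le (n := n + 1) (fun j => (q j).1) (fun j => (q j).2) (fun j => hq j)
    (finRotate (n + 1)).symm
  rw [← Equiv.sum_comp (finRotate (n + 1))] at h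
  simp only [Equiv.symm_apply_apply] at h
  rw [Fin.sum_univ_castSucc, Fin.sum_univ_castSucc] at h
  simp only [Fin.last_add_one, Fin.val_zero, Fin.val_last, finRotate_apply, Fin.val_castSucc,
    Fin.coeSucc_eq_succ, Fin.val_succ] at h
  rw [Fin.sum_univ_eq_sum_range fun i => ⟪(q (i + 1)).1, (q i).2⟫,
    Fin.sum_univ_eq_sum_range fun i => ⟪(q i).1, (q i).2⟫] at h
  simp only [chainValue, inner_sub_right, Finset.sum_sub_distrib]
  simp only [real_inner_comm] at h ⊢
  linarith

/-- At a point with the law of the base point the potential is finite. The base pair of a chain may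
differ from the given one, which costs at most a multiple of the norms. -/
theorem JointlyCyclicallyMonotone.rockafellar_le {R : Set (P2 (ℝ × ℝ))}
    (hR : JointlyCyclicallyMonotone R) {X G : L2} (hXG : jointLaw X G ∈ R) :
    rockafellar R (jointLaw X G) X ≤ ((‖G‖ * (‖X‖ + ‖X‖) : ℝ) : EReal) := by
  refine iSup_le fun ⟨n, q, hq⟩ => ?_
  -- Close the chain up by prepending the pair `(X, G)`.
  have h1 := hR.chainValue_zero_le (q := fun i => Nat.casesOn i (X, G) q) (n + 1)
    (fun i => by cases i <;> simp [hXG, hq.mem])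
  simp only [chainValue] at h1
  rw [Finset.sum_range_succ'] at h1
  have h2 : ‖(q 0).1‖ = ‖X‖ := norm_eq_of_law_eq (law_fst_eq_of_jointLaw_eq hq.zero)
  have h3 : |⟪G, (q 0).1 - X⟫| ≤ ‖G‖ * (‖X‖ + ‖X‖) := by
    refine (abs_real_inner_le_norm _ _).trans ?_
    gcongr
    exact (norm_sub_le _ _).trans_eq (by rw [h2])
  have h4 := (abs_le.1 h3).1
  simp only [EReal.coe_le_coe_iff, chainValue]
  change _ + ⟪G, (q 0).1 - X⟫ + ⟪(q n).2, X - (q n).1⟫ ≤ 0 at h1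
  linarith

theorem isChain_const {R : Set (P2 (ℝ × ℝ))} {X G : L2} (h : jointLaw X G ∈ R) :
    IsChain R (jointLaw X G) fun _ => (X, G) :=
  ⟨rfl, fun _ => h⟩

/-- Moving a whole chain by a measure preserving map shows that the potential depends on laws
only. -/
theorem rockafellar_le_of_law_eq {R : Set (P2 (ℝ × ℝ))} {π₀ : P2 (ℝ × ℝ)} {X Y : L2}
    (h : law X = law Y) : rockafellar R π₀ X ≤ rockafellar R π₀ Y := by
  refine iSup_le fun ⟨n, q, hq⟩ => ?_
  refine EReal.ge_of_forall_gt_iff_ge.1 fun z hz => ?_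
  have hz' : z < chainValue q n X := by exact_mod_cast hz
  obtain ⟨τ, hτ, hle⟩ := exists_norm_sub_pull_le h.symm
    (show 0 < (chainValue q n X - z) / (‖(q n).2‖ + 1) from
      div_pos (sub_pos.2 hz') (by positivity))
  have hchain : IsChain R π₀ fun i => (pull τ hτ (q i).1, pull τ hτ (q i).2) :=
    ⟨(jointLaw_pull hτ _ _).trans hq.zero, fun i => by
      simp only [jointLaw_pull]; exact hq.mem i⟩
  have h1 : chainValue (fun i => (pull τ hτ (q i).1, pull τ hτ (q i).2)) n (pull τ hτ X) =
      chainValue q n X := by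
    simp only [chainValue, ← map_sub, LinearIsometry.inner_map_map]
  have h2 : |⟪pull τ hτ (q n).2, Y - pull τ hτ X⟫| ≤ chainValue q n X - z := by
    refine (abs_real_inner_le_norm _ _).trans ?_
    rw [LinearIsometry.norm_map]
    calc ‖(q n).2‖ * ‖Y - pull τ hτ X‖
        ≤ (‖(q n).2‖ + 1) * ((chainValue q n X - z) / (‖(q n).2‖ + 1)) := by
          gcongr; linarith
      _ = chainValue q n X - z := mul_div_cancel₀ _ (by positivity)
  have h3 := chainValue_add_inner (fun i => (pull τ hτ (q i).1, pull τ hτ (q i).2)) n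
    (pull τ hτ X) Y
  refine le_trans ?_ (le_rockafellar hchain n Y)
  rw [h3, h1, EReal.coe_le_coe_iff]
  linarith [(abs_le.1 h2).1]

theorem JointlyCyclicallyMonotone.symmConvexL2_rockafellar {R : Set (P2 (ℝ × ℝ))}
    (hR : JointlyCyclicallyMonotone R) {X G : L2} (hXG : jointLaw X G ∈ R) :
    SymmConvexL2 (rockafellar R (jointLaw X G)) where
  lsc := by
    refine lowerSemicontinuous_iSup fun p => Continuous.lowerSemicontinuous ?_
    refine continuous_coe_real_ereal.comp ?_
    unfold chainValue
    fun_prop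
  proper := by
    refine ⟨fun Y => ?_, X, ne_top_of_le_ne_top (EReal.coe_ne_top _) (hR.rockafellar_le hXG)⟩
    exact ne_bot_of_le_ne_bot (EReal.coe_ne_bot _) (le_rockafellar (isChain_const hXG) 0 Y)
  symmetric := fun Y Y' h =>
    le_antisymm (rockafellar_le_of_law_eq h) (rockafellar_le_of_law_eq h.symm)
  convex := fun Y Y' α h0 h1 => by
    refine iSup_le fun ⟨n, q, hq⟩ => ?_
    rw [chainValue_convex, EReal.coe_add, EReal.coe_mul, EReal.coe_mul]
    exact add_le_add
      (mul_le_mul_of_nonneg_left (le_rockafellar hq n Y) (EReal.coe_nonneg.2 h0))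
      (mul_le_mul_of_nonneg_left (le_rockafellar hq n Y') (EReal.coe_nonneg.2 (sub_nonneg.2 h1)))

/-- A chain that reaches `X` can be prolonged by any pair `(X, G)` with joint law in `R`. -/
theorem mem_subdiff_rockafellar {R : Set (P2 (ℝ × ℝ))} {π₀ : P2 (ℝ × ℝ)} {X G : L2}
    (hXG : jointLaw X G ∈ R) : (X, G) ∈ subdiff (rockafellar R π₀) := by
  rw [subdiff_eq_hilbertSubdiff]
  intro Y
  simp only
  refine EReal.add_le_of_forall_lt fun a ha b hb => ?_
  obtain ⟨⟨n, q, hq⟩, hlt⟩ := lt_iSup_iff.1 ha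
  set q' : ℕ → L2 × L2 := fun i => if i ≤ n then q i else (X, G) with hq'
  have hchain : IsChain R π₀ q' := by
    refine ⟨by simp [hq', hq.zero], fun i => ?_⟩
    by_cases hi : i ≤ n <;> simp [hq', hi, hXG, hq.mem]
  have hval : chainValue q' (n + 1) Y = chainValue q n X + ⟪G, Y - X⟫ := by
    rw [chainValue, Finset.sum_range_succ, chainValue]
    have h1 : ∀ i ∈ Finset.range n, ⟪(q' i).2, (q' (i + 1)).1 - (q' i).1⟫ =
        ⟪(q i).2, (q (i + 1)).1 - (q i).1⟫ := fun i hi => by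
      have : i < n := Finset.mem_range.1 hi
      simp [hq', this.le, Nat.succ_le_iff.2 this]
    rw [Finset.sum_congr rfl h1]
    simp [hq']
  calc a + b ≤ (chainValue q n X : EReal) + ((⟪G, Y - X⟫ : ℝ) : EReal) := add_le_add hlt.le hb.le
    _ = (chainValue q' (n + 1) Y : EReal) := by rw [hval, EReal.coe_add]
    _ ≤ _ := le_rockafellar hchain _ _

/-- Every jointly cyclically monotone set is contained in the Wasserstein subdifferential of a
function in `𝓕`. -/
theorem JointlyCyclicallyMonotone.exists_subset_wassSubdiffL2 {R : Set (P2 (ℝ × ℝ))}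
    (hR : JointlyCyclicallyMonotone R) :
    ∃ f : L2 → EReal, SymmConvexL2 f ∧ R ⊆ wassSubdiffL2 f := by
  rcases R.eq_empty_or_nonempty with rfl | ⟨π₀, h₀⟩
  · refine ⟨fun _ => 0, ⟨lowerSemicontinuous_const, ⟨by simp, by simp⟩, by simp, ?_⟩,
      empty_subset _⟩
    intro X X' α h0 h1
    simp
  · obtain ⟨X, G, rfl⟩ := exists_jointLaw_eq π₀
    refine ⟨_, hR.symmConvexL2_rockafellar h₀, fun π hπ => ?_⟩
    obtain ⟨Y, K, rfl⟩ := exists_jointLaw_eq π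
    exact ⟨Y, K, mem_subdiff_rockafellar hπ, rfl⟩

/-- A symmetric function on `L₂(0, 1)` factors through the law. -/
theorem SymmConvexL2.exists_eq_comp_law {f : L2 → EReal} (hf : SymmConvexL2 f) :
    ∃ F : P2 ℝ → EReal, ConvexP2 F ∧ f = fun X => F (law X) := by
  choose s hs using exists_law_eq
  have h : f = fun X => (fun μ => f (s μ)) (law X) :=
    funext fun X => hf.symmetric _ _ (hs _).symm
  exact ⟨fun μ => f (s μ), SymmConvexL2.convexP2_of_comp_law (h ▸ hf), h⟩

end Rockafellar

end

end WassersteinSubdiff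


open WassersteinSubdiff
theorem mainTheorem5 :
    (∀ F : P2 ℝ → EReal, ConvexP2 F → MaximallyJointlyCyclicallyMonotone (wassSubdiffP2 F)) ∧
    (∀ f : L2 → EReal, SymmConvexL2 f → MaximallyJointlyCyclicallyMonotone (wassSubdiffL2 f)) ∧
    (∀ R : Set (P2 (ℝ × ℝ)), MaximallyJointlyCyclicallyMonotone R →
      ∃ (F : P2 ℝ → EReal) (f : L2 → EReal), ConvexP2 F ∧ SymmConvexL2 f ∧
        (∀ X, f X = F (law X)) ∧ wassSubdiffP2 F = R ∧ wassSubdiffL2 f = R ∧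
        (∀ F' : P2 ℝ → EReal, ConvexP2 F' → wassSubdiffP2 F' = R →
          ∃ c : ℝ, ∀ μ, F' μ = F μ + (c : EReal)) ∧
        (∀ f' : L2 → EReal, SymmConvexL2 f' → wassSubdiffL2 f' = R →
          ∃ c : ℝ, ∀ X, f' X = f X + (c : EReal))) ∧
    (∀ R : Set (P2 (ℝ × ℝ)), JointlyCyclicallyMonotone R →
      ∃ (F : P2 ℝ → EReal) (f : L2 → EReal), ConvexP2 F ∧ SymmConvexL2 f ∧
        (∀ X, f X = F (law X)) ∧ R ⊆ wassSubdiffP2 F ∧ R ⊆ wassSubdiffL2 f) := by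
  refine ⟨fun F hF => hF.symmConvexL2_comp_law.maximallyJointlyCyclicallyMonotone,
    fun f hf => hf.maximallyJointlyCyclicallyMonotone, fun R hR => ?_, fun R hR => ?_⟩
  · obtain ⟨f, hf, hRf⟩ := hR.1.exists_subset_wassSubdiffL2
    obtain ⟨F, hF, rfl⟩ := hf.exists_eq_comp_law
    have hEq : wassSubdiffL2 (fun X => F (law X)) = R :=
      (hRf.eq_or_ssubset.resolve_right (hR.2 _ hf.jointlyCyclicallyMonotone)).symm
    refine ⟨F, _, hF, hf, fun _ => rfl, hEq, hEq, fun F' hF' h' => ?_, fun f' hf' h' =>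
      hf.exists_eq_add_const hf' (h'.trans hEq.symm)⟩
    obtain ⟨c, hc⟩ := hf.exists_eq_add_const hF'.symmConvexL2_comp_law (h'.trans hEq.symm)
    refine ⟨c, fun μ => ?_⟩
    obtain ⟨X, rfl⟩ := exists_law_eq μ
    exact hc X
  · obtain ⟨f, hf, hRf⟩ := hR.exists_subset_wassSubdiffL2
    obtain ⟨F, hF, rfl⟩ := hf.exists_eq_comp_law
    exact ⟨F, _, hF, hf, fun _ => rfl, hRf, hRf⟩
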